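/- There exist a bounded, open, strictly convex domain $\Omega \subset \mathbb{R}^2$, which can be taken to be the interior $\{(x,y) : x^2/a^2 + y^2/b^2 < 1\}$ of an ellipse with $a > b > 0$, and a (nonempty) connected, relatively open subset $\Gamma \subset \partial\Omega$ such that (i) $(\Omega,\Gamma)$ satisfies the geometric control condition: there is a time $T > 0$ such that every ray of the optic geometry of $\Omega$ meets $\Gamma$, in a non-diffractive way, at some time $t \in (0,T)$; (ii) there is no $x_0 \in \mathbb{R}^2$ with $\Gamma = \Gamma(x_0)$, where $\Gamma(x_0) := \{ x \in \partial\Omega : \langle x - x_0, n(x)\rangle > 0 \}$ and $n(x)$ is the outward unit normal to $\partial\Omega$ at $x$. Here $\Omega$ is strictly convex if every open segment joining two distinct points of $\overline\Omega$ lies in $\Omega$. The rays of the optic geometry are the curves $\gamma : \mathbb{R} \to \overline\Omega$ run at unit speed that are either reflected rays (straight lines inside $\Omega$, reflected at $\partial\Omega$ so that the angle of reflection equals the angle of incidence, with reflection times running from $-\infty$ to $+\infty$) or gliding rays ($C^1$ curves contained in $\partial\Omega$). A ray meets the boundary at time $t$ in a non-diffractive way if the straight half-line issued from $\gamma(t)$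 in the incoming direction of $\gamma$ at time $t$ lies outside $\overline\Omega$ for all small positive times. -/

import Mathlib

open Set Filter Topology

/-- The Euclidean plane. -/
abbrev Plane : Type := EuclideanSpace ℝ (Fin 2)

/-- The open region bounded by the ellipse with semi-axes `a` and `b`, centred at the origin,
with its axes along the coordinate axes. -/
def ellipseDomain (a b : ℝ) : Set Plane :=
  {x | (x 0 / a) ^ 2 + (x 1 / b) ^ 2 < 1}

/-- `n` is an outward unit normal at `x` of the convex domain `Ω`: a unit vector such that `Ω`
lies in the half-plane `⟪y - x, n⟫ ≤ 0`. At a boundary point where `∂Ω` is differentiable there is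
exactly one such vector, the usual outward unit normal `n(x)`. -/
def IsOutwardUnitNormal (Ω : Set Plane) (x n : Plane) : Prop :=
  ‖n‖ = 1 ∧ ∀ y ∈ Ω, inner ℝ (y - x) n ≤ 0

/-- The boundary region `Γ(x₀) = {x ∈ ∂Ω | ⟪x - x₀, n(x)⟫ > 0}`. -/
def gammaRegion (Ω : Set Plane) (x₀ : Plane) : Set Plane :=
  {x | x ∈ frontier Ω ∧ ∃ n, IsOutwardUnitNormal Ω x n ∧ 0 < inner ℝ (x - x₀) n}

/-- `γ` is a complete reflected (billiard) ray of `Ω`, run at unit speed. Here `τ k` are the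
successive reflection times and `ξ k` is the direction of the ray between the times `τ k` and
`τ (k + 1)`; at a reflection time the direction changes by the law
"angle of reflection equals angle of incidence". -/
def IsReflectedRay (Ω : Set Plane) (γ : ℝ → Plane) : Prop :=
  ∃ (τ : ℤ → ℝ) (ξ : ℤ → Plane),
    StrictMono τ ∧ Tendsto τ atTop atTop ∧ Tendsto τ atBot atBot ∧
    (∀ k, ‖ξ k‖ = 1) ∧
    (∀ k, ∀ t ∈ Icc (τ k) (τ (k + 1)), γ t = γ (τ k) + (t - τ k) • ξ k) ∧
    (∀ k, ∀ t ∈ Ioo (τ k) (τ (k + 1)), γ t ∈ Ω) ∧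
    (∀ k, γ (τ k) ∈ frontier Ω) ∧
    (∀ k, ∃ n, IsOutwardUnitNormal Ω (γ (τ k)) n ∧
      ξ k = ξ (k - 1) - (2 * inner ℝ (ξ (k - 1)) n) • n)

/-- `γ` is a gliding ray of `Ω`: it runs along the boundary at unit speed. -/
def IsGlidingRay (Ω : Set Plane) (γ : ℝ → Plane) : Prop :=
  ContDiff ℝ 1 γ ∧ (∀ t, γ t ∈ frontier Ω) ∧ ∀ t, ‖deriv γ t‖ = 1

/-- The rays of the optic geometry of a bounded strictly convex domain `Ω` with smooth boundary:
reflected rays and gliding rays. A ray of one kind never turns into one of the other. -/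
def IsOpticRay (Ω : Set Plane) (γ : ℝ → Plane) : Prop :=
  IsReflectedRay Ω γ ∨ IsGlidingRay Ω γ

/-- The ray `γ`, when it is continued past time `t` along the straight line in its incoming
direction `v`, leaves `closure Ω` at once: the contact with `∂Ω` is non-diffractive. -/
def IsNonDiffractiveAt (Ω : Set Plane) (γ : ℝ → Plane) (t : ℝ) : Prop :=
  ∃ v : Plane, HasDerivWithinAt γ v (Iic t) t ∧
    ∀ᶠ s : ℝ in 𝓝[>] 0, γ t + s • v ∉ closure Ω

/-- The geometric control condition for `(Ω, Γ)`: there is a time `T > 0` such that every ray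
of the optic geometry of `Ω` meets `Γ`, at a non-diffractive point, at a time in `(0, T)`. -/
def GeometricControl (Ω Γ : Set Plane) : Prop :=
  ∃ T : ℝ, 0 < T ∧ ∀ γ : ℝ → Plane, IsOpticRay Ω γ →
    ∃ t ∈ Ioo 0 T, γ t ∈ Γ ∧ IsNonDiffractiveAt Ω γ t

/-! Take the ellipse with semi-axes 2 and 1, and let Γ be the open half of its boundary where the
normal has positive product with (1, 1). The end points of Γ are ±(4, -1)/√5, with normals along
±(1, -1). No Γ(x₀) misses both points of an antipodal pair: their normals are opposite, so the two
products sum to a positive number independent of x₀. But Γ misses both its end points.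

For control, gliding rays go round the ellipse in bounded time. Suppose a reflected ray avoids Γ for
a long time. Each reflection can then only increase the component of its direction along (1, 1). As
displacements are bounded, this component is nearly zero during a long middle period, so the ray
runs almost parallel to (1, -1) and must turn back at some reflection. Such a reflection is far from
grazing, and Joachimsthal's invariant J (`chord_joachimsthal`) carries this over to the next one.
Both then occur near ±(4, -1)/√5 (`abs_add_le_of_reflection`). A chord joining such points is either
short, contrary to the bound on J, or close to the direction (4, -1), not (1, -1)
(`chord_contradiction`). -/

/-! ### Geometry of the ellipse and its normals -/

theorem plane_inner (x y : Plane) : inner ℝ x y = x 0 * y 0 + x 1 * y 1 := by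
  simp [PiLp.inner_apply, Fin.sum_univ_two, mul_comm]

theorem plane_norm_sq (x : Plane) : ‖x‖ ^ 2 = x 0 ^ 2 + x 1 ^ 2 := by
  rw [EuclideanSpace.norm_sq_eq]; simp [Fin.sum_univ_two]

theorem plane_norm_eq_one {x : Plane} (h : ‖x‖ = 1) : x 0 ^ 2 + x 1 ^ 2 = 1 := by
  rw [← plane_norm_sq, h, one_pow]

theorem mem_ellipse (x : Plane) : x ∈ ellipseDomain 2 1 ↔ x 0 ^ 2 / 4 + x 1 ^ 2 < 1 := by
  simp only [ellipseDomain, mem_ofPred_eq]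
  constructor <;> intro h <;> nlinarith

theorem isOpen_ellipse : IsOpen (ellipseDomain 2 1) := by
  unfold ellipseDomain
  exact isOpen_lt (by fun_prop) (by fun_prop)

theorem closure_ellipse :
    closure (ellipseDomain 2 1) = {x : Plane | x 0 ^ 2 / 4 + x 1 ^ 2 ≤ 1} := by
  apply Subset.antisymm
  · apply closure_minimal
    · intro x hx
      exact ((mem_ellipse x).1 hx).le
    · exact isClosed_le (by fun_prop) (by fun_prop)
  · intro x hx
    have hc : ContinuousWithinAt (fun s : ℝ => s • x) (Ico 0 1) 1 := by fun_prop
    have h1 : (1 : ℝ) ∈ closure (Ico (0 : ℝ) 1) := by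
      rw [closure_Ico (by norm_num)]; simp
    have := hc.mem_closure h1 (t := ellipseDomain 2 1) ?_
    · simpa using this
    · intro s hs
      rw [mem_ellipse]
      simp only [mem_ofPred_eq] at hx
      simp only [PiLp.smul_apply, smul_eq_mul]
      have h0 := hs.1
      have h2 := hs.2
      have hs2 : s ^ 2 < 1 := by nlinarith
      nlinarith [mul_le_mul_of_nonneg_left hx (sq_nonneg s)]

theorem mem_frontier_ellipse (x : Plane) :
    x ∈ frontier (ellipseDomain 2 1) ↔ x 0 ^ 2 / 4 + x 1 ^ 2 = 1 := by
  rw [isOpen_ellipse.frontier_eq, closure_ellipse, Set.mem_sdiff, mem_ellipse, mem_ofPred_eq]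
  constructor
  · intro h; linarith [h.1, h.2]
  · intro h; exact ⟨h.le, by linarith⟩

theorem isBounded_ellipse : Bornology.IsBounded (ellipseDomain 2 1) := by
  rw [isBounded_iff_forall_norm_le]
  refine ⟨2, fun x hx => ?_⟩
  rw [mem_ellipse] at hx
  have := plane_norm_sq x
  nlinarith [norm_nonneg x, sq_nonneg (x 1)]

theorem strictConvex_closure_ellipse : StrictConvex ℝ (closure (ellipseDomain 2 1)) := by
  intro x hx y hy hxy a b ha hb hab
  apply interior_maximal subset_closure isOpen_ellipse
  rw [closure_ellipse] at hx hy
  simp only [mem_ofPred_eq] at hx hy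
  rw [mem_ellipse]
  simp only [PiLp.add_apply, PiLp.smul_apply, smul_eq_mul]
  have hne : 0 < (x 0 - y 0) ^ 2 / 4 + (x 1 - y 1) ^ 2 := by
    by_contra h
    apply hxy
    have h0 : x 0 - y 0 = 0 := by nlinarith [sq_nonneg (x 0 - y 0), sq_nonneg (x 1 - y 1)]
    have h1 : x 1 - y 1 = 0 := by nlinarith [sq_nonneg (x 0 - y 0), sq_nonneg (x 1 - y 1)]
    ext i; fin_cases i
    · exact sub_eq_zero.1 h0
    · exact sub_eq_zero.1 h1
  have hb' : b = 1 - a := by linarith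
  subst hb'
  have key : (a * x 0 + (1 - a) * y 0) ^ 2 / 4 + (a * x 1 + (1 - a) * y 1) ^ 2
      = a * (x 0 ^ 2 / 4 + x 1 ^ 2) + (1 - a) * (y 0 ^ 2 / 4 + y 1 ^ 2)
        - a * (1 - a) * ((x 0 - y 0) ^ 2 / 4 + (x 1 - y 1) ^ 2) := by ring
  rw [key]
  nlinarith [mul_pos (mul_pos ha hb) hne, mul_le_mul_of_nonneg_left hx ha.le,
    mul_le_mul_of_nonneg_left hy hb.le]

/-- The outward normal of the ellipse at `x` is the positive multiple of `(x 0 / 4, x 1)`. -/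
theorem outwardUnitNormal_ellipse {x n : Plane} (hx : x ∈ frontier (ellipseDomain 2 1))
    (hn : IsOutwardUnitNormal (ellipseDomain 2 1) x n) :
    ∃ r : ℝ, 0 < r ∧ n 0 = r * (x 0 / 4) ∧ n 1 = r * x 1 := by
  rw [mem_frontier_ellipse] at hx
  obtain ⟨h1, h2⟩ := hn
  have h1' := plane_norm_eq_one h1
  set r := √(4 * n 0 ^ 2 + n 1 ^ 2) with hr
  have hpos : 0 < 4 * n 0 ^ 2 + n 1 ^ 2 := by nlinarith [sq_nonneg (n 0)]
  have hr0 : 0 < r := Real.sqrt_pos.2 hpos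
  have hr2 : r ^ 2 = 4 * n 0 ^ 2 + n 1 ^ 2 := Real.sq_sqrt hpos.le
  -- `r` is the support function of the ellipse in direction `n`, attained at (4 n₀, n₁)/r; test
  -- points `d / r` times this one, with `d < r`, lie inside.
  have hle : r ≤ x 0 * n 0 + x 1 * n 1 := by
    apply le_of_forall_lt
    intro c hc
    obtain ⟨d, hcd, hdr⟩ := exists_between (max_lt hc hr0)
    have hd0 : 0 < d := (le_max_right _ _).trans_lt hcd
    have hmem : (!₂[d / r ^ 2 * (4 * n 0), d / r ^ 2 * n 1] : Plane) ∈ ellipseDomain 2 1 := by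
      rw [mem_ellipse]
      simp only [Matrix.cons_val_zero, Matrix.cons_val_one]
      have : (d / r ^ 2 * (4 * n 0)) ^ 2 / 4 + (d / r ^ 2 * n 1) ^ 2
          = (d / r) ^ 2 := by
        have : (d / r ^ 2 * (4 * n 0)) ^ 2 / 4 + (d / r ^ 2 * n 1) ^ 2
          = (d / r ^ 2) ^ 2 * (4 * n 0 ^ 2 + n 1 ^ 2) := by ring
        rw [this, ← hr2]; field_simp
      rw [this]
      have h3 : d / r < 1 := (div_lt_one hr0).2 hdr
      have h4 : 0 < d / r := by positivity
      nlinarith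
    have := h2 _ hmem
    rw [plane_inner] at this
    simp only [PiLp.sub_apply, Matrix.cons_val_zero, Matrix.cons_val_one] at this
    have e : d / r ^ 2 * (4 * n 0) * n 0 + d / r ^ 2 * n 1 * n 1 = d := by
      have : d / r ^ 2 * (4 * n 0) * n 0 + d / r ^ 2 * n 1 * n 1
        = d / r ^ 2 * (4 * n 0 ^ 2 + n 1 ^ 2) := by ring
      rw [this, ← hr2]; field_simp
    have := (le_max_left c 0).trans_lt hcd
    nlinarith
  -- The equality case of Cauchy–Schwarz for (2 n₀, n₁) and (x₀/2, x₁).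
  have hz : (2 * n 0 - r * (x 0 / 2)) ^ 2 + (n 1 - r * x 1) ^ 2 ≤ 0 := by
    have : (2 * n 0 - r * (x 0 / 2)) ^ 2 + (n 1 - r * x 1) ^ 2
      = (4 * n 0 ^ 2 + n 1 ^ 2) - 2 * r * (x 0 * n 0 + x 1 * n 1)
        + r ^ 2 * (x 0 ^ 2 / 4 + x 1 ^ 2) := by ring
    rw [this, ← hr2, hx]
    nlinarith
  have e0 : 2 * n 0 - r * (x 0 / 2) = 0 := by
    nlinarith [sq_nonneg (2 * n 0 - r * (x 0 / 2)), sq_nonneg (n 1 - r * x 1)]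
  have e1 : n 1 - r * x 1 = 0 := by
    nlinarith [sq_nonneg (2 * n 0 - r * (x 0 / 2)), sq_nonneg (n 1 - r * x 1)]
  exact ⟨r, hr0, by linarith, by linarith⟩

/-! ### The region Γ, which is no Γ(x₀) -/

/-- The open half of the boundary of the ellipse on which the outward normal has positive
inner product with `(1, 1)`. -/
def halfEllipse : Set Plane :=
  {x : Plane | 0 < x 0 / 4 + x 1} ∩ frontier (ellipseDomain 2 1)

/-- Γ is the radial projection of an open half-plane, which is convex and avoids the origin. -/
theorem isConnected_halfEllipse : IsConnected halfEllipse := by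
  have himg : halfEllipse =
      (fun x : Plane => (√(x 0 ^ 2 / 4 + x 1 ^ 2))⁻¹ • x) '' {x : Plane | 0 < x 0 / 4 + x 1} := by
    ext y
    constructor
    · rintro ⟨h1, h2⟩
      rw [mem_frontier_ellipse] at h2
      exact ⟨y, h1, by simp [h2]⟩
    · rintro ⟨x, hx, rfl⟩
      have hx' : 0 < x 0 / 4 + x 1 := hx
      have hq : 0 < x 0 ^ 2 / 4 + x 1 ^ 2 := by
        nlinarith [sq_nonneg (x 0 - x 1), mul_pos hx' hx', sq_nonneg (x 0), sq_nonneg (x 1)]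
      have hs := Real.sqrt_pos.2 hq
      refine ⟨?_, ?_⟩
      · simp only [mem_ofPred_eq, PiLp.smul_apply, smul_eq_mul]
        have := mul_pos (inv_pos.2 hs) hx'
        linarith
      · rw [mem_frontier_ellipse]
        simp only [PiLp.smul_apply, smul_eq_mul]
        have : ∀ c : ℝ, (c * x 0) ^ 2 / 4 + (c * x 1) ^ 2 = c ^ 2 * (x 0 ^ 2 / 4 + x 1 ^ 2) := by
          intro c; ring
        rw [this, inv_pow, Real.sq_sqrt hq.le, inv_mul_cancel₀ hq.ne']
  rw [himg]
  have hconv : Convex ℝ {x : Plane | 0 < x 0 / 4 + x 1} := by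
    intro x hx y hy a b ha hb hab
    simp only [mem_ofPred_eq, PiLp.add_apply, PiLp.smul_apply, smul_eq_mul] at *
    rcases ha.eq_or_lt with rfl | ha
    · have : b = 1 := by linarith
      subst this; linarith
    · nlinarith [mul_pos ha hx, mul_nonneg hb hy.le]
  refine IsConnected.image ⟨⟨!₂[0, 1], by simp⟩, hconv.isPreconnected⟩ _ ?_
  have hs : ContinuousOn (fun x : Plane => (√(x 0 ^ 2 / 4 + x 1 ^ 2))⁻¹)
      {x : Plane | 0 < x 0 / 4 + x 1} := by
    refine ContinuousOn.inv₀ (by fun_prop) fun x hx => ?_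
    have hx' : 0 < x 0 / 4 + x 1 := hx
    have hq : 0 < x 0 ^ 2 / 4 + x 1 ^ 2 := by
      nlinarith [sq_nonneg (x 0 - x 1), mul_pos hx' hx', sq_nonneg (x 0), sq_nonneg (x 1)]
    exact (Real.sqrt_pos.2 hq).ne'
  exact hs.smul (continuousOn_id' _)

theorem halfEllipse_ne_gammaRegion (x₀ : Plane) :
    halfEllipse ≠ gammaRegion (ellipseDomain 2 1) x₀ := by
  intro h
  set t : ℝ := (√5)⁻¹ with ht
  have ht0 : 0 < t := by positivity
  have ht2 : 5 * t ^ 2 = 1 := by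
    rw [ht, inv_pow, Real.sq_sqrt (by norm_num)]; norm_num
  set u : ℝ := (√2)⁻¹ with hu
  have hu0 : 0 < u := by positivity
  have hu2 : 2 * u ^ 2 = 1 := by
    rw [hu, inv_pow, Real.sq_sqrt (by norm_num)]; norm_num
  -- The sign `e` selects the end point e(4t, -t) of Γ, with normal e(u, -u). Adding the cases `e =
  -- 1` and `e = -1` eliminates `x₀`.
  have main : ∀ e : ℝ, e ^ 2 = 1 → u * ((4 * t - e * x₀ 0) - (-t - e * x₀ 1)) ≤ 0 := by
    intro e he
    by_contra hcon
    push Not at hcon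
    have hmem : (!₂[e * (4 * t), e * (-t)] : Plane) ∈ gammaRegion (ellipseDomain 2 1) x₀ := by
      refine ⟨?_, !₂[e * u, e * (-u)], ⟨?_, ?_⟩, ?_⟩
      · rw [mem_frontier_ellipse]
        simp only [Matrix.cons_val_zero, Matrix.cons_val_one]
        have : (e * (4 * t)) ^ 2 / 4 + (e * (-t)) ^ 2 = e ^ 2 * (5 * t ^ 2) := by ring
        rw [this, he, ht2, one_mul]
      · rw [← pow_eq_one_iff_of_nonneg (norm_nonneg _) two_ne_zero, plane_norm_sq]
        simp only [Matrix.cons_val_zero, Matrix.cons_val_one]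
        have : (e * u) ^ 2 + (e * (-u)) ^ 2 = e ^ 2 * (2 * u ^ 2) := by ring
        rw [this, he, hu2, one_mul]
      · intro y hy
        rw [mem_ellipse] at hy
        rw [plane_inner]
        simp only [PiLp.sub_apply, Matrix.cons_val_zero, Matrix.cons_val_one]
        have : (y 0 - e * (4 * t)) * (e * u) + (y 1 - e * (-t)) * (e * (-u))
          = u * (e * (y 0 - y 1) - e ^ 2 * (5 * t)) := by ring
        rw [this, he]
        apply mul_nonpos_of_nonneg_of_nonpos hu0.le
        have h5 : (e * (y 0 - y 1)) ^ 2 ≤ (5 * t) ^ 2 := by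
          rw [mul_pow, he]
          nlinarith [sq_nonneg (y 0 / 2 + 2 * y 1)]
        have := abs_le_of_sq_le_sq' h5 (by positivity)
        linarith [this.2]
      · rw [plane_inner]
        simp only [PiLp.sub_apply, Matrix.cons_val_zero, Matrix.cons_val_one]
        have : (e * (4 * t) - x₀ 0) * (e * u) + (e * (-t) - x₀ 1) * (e * (-u))
          = u * ((e ^ 2 * (4 * t) - e * x₀ 0) - (e ^ 2 * (-t) - e * x₀ 1)) := by ring
        rw [this, he]; linarith
    rw [← h] at hmem
    have := hmem.1
    simp only [mem_ofPred_eq, Matrix.cons_val_zero, Matrix.cons_val_one] at this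
    linarith
  have h1 := main 1 (by norm_num)
  have h2 := main (-1) (by norm_num)
  nlinarith [mul_pos hu0 ht0]

/-! ### Chords, reflections and Joachimsthal's invariant -/

/-- A half-line issued from a boundary point, tangent or pointing outwards, leaves the closed
elliptic domain at once. -/
theorem add_smul_notMem_closure_ellipse {x v : Plane} {s : ℝ}
    (hx : x ∈ frontier (ellipseDomain 2 1)) (hv : ‖v‖ = 1)
    (hJ : 0 ≤ v 0 * (x 0 / 4) + v 1 * x 1) (hs : 0 < s) :
    x + s • v ∉ closure (ellipseDomain 2 1) := by
  rw [mem_frontier_ellipse] at hx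
  have hv' := plane_norm_eq_one hv
  rw [closure_ellipse, mem_ofPred_eq, not_le]
  simp only [PiLp.add_apply, PiLp.smul_apply, smul_eq_mul]
  have h1 : 0 < v 0 ^ 2 / 4 + v 1 ^ 2 := by nlinarith [sq_nonneg (v 1)]
  nlinarith [mul_nonneg hs.le hJ, mul_pos (pow_pos hs 2) h1]

/-- Between two boundary points joined by a chord of direction `v`, the quantity
`⟪v, Q x⟫` with `Q = diag (1/4, 1)` changes sign only. -/
theorem chord_joachimsthal {x y v : Plane} {s : ℝ}
    (hx : x ∈ frontier (ellipseDomain 2 1)) (hy : y ∈ frontier (ellipseDomain 2 1))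
    (hv : ‖v‖ = 1) (hs : 0 < s) (hxy : y = x + s • v) :
    v 0 * (y 0 / 4) + v 1 * y 1 = -(v 0 * (x 0 / 4) + v 1 * x 1) ∧
      0 < v 0 * (y 0 / 4) + v 1 * y 1 := by
  rw [mem_frontier_ellipse] at hx hy
  have hv' := plane_norm_eq_one hv
  have e0 : y 0 = x 0 + s * v 0 := by rw [hxy]; simp
  have e1 : y 1 = x 1 + s * v 1 := by rw [hxy]; simp
  have h1 : 0 < v 0 ^ 2 / 4 + v 1 ^ 2 := by nlinarith [sq_nonneg (v 1)]
  have h2 : s * (v 0 * (y 0 / 4) + v 1 * y 1 + (v 0 * (x 0 / 4) + v 1 * x 1)) = 0 := by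
    rw [e0, e1] at hy ⊢
    nlinarith
  have h3 := (mul_eq_zero.1 h2).resolve_left hs.ne'
  refine ⟨by linarith, ?_⟩
  have h4 : v 0 * (y 0 / 4) + v 1 * y 1 - (v 0 * (x 0 / 4) + v 1 * x 1)
      = s * (v 0 ^ 2 / 4 + v 1 ^ 2) := by rw [e0, e1]; ring
  have := mul_pos hs h1
  linarith

theorem abs_le_of_mem_frontier_ellipse {x : Plane} (hx : x ∈ frontier (ellipseDomain 2 1)) :
    |x 0| ≤ 2 ∧ |x 1| ≤ 1 := by
  rw [mem_frontier_ellipse] at hx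
  constructor
  · apply abs_le_of_sq_le_sq _ (by norm_num)
    nlinarith [sq_nonneg (x 1)]
  · apply abs_le_of_sq_le_sq _ (by norm_num)
    nlinarith [sq_nonneg (x 0)]

theorem chord_length_le {x y v : Plane} {s : ℝ}
    (hx : x ∈ frontier (ellipseDomain 2 1)) (hy : y ∈ frontier (ellipseDomain 2 1))
    (hv : ‖v‖ = 1) (hxy : y = x + s • v) : s ≤ 5 := by
  have hv' := plane_norm_eq_one hv
  have e0 : y 0 = x 0 + s * v 0 := by rw [hxy]; simp
  have e1 : y 1 = x 1 + s * v 1 := by rw [hxy]; simp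
  obtain ⟨hx0, hx1⟩ := abs_le_of_mem_frontier_ellipse hx
  obtain ⟨hy0, hy1⟩ := abs_le_of_mem_frontier_ellipse hy
  rw [abs_le] at *
  have h0 : (s * v 0) ^ 2 ≤ 4 ^ 2 := sq_le_sq' (by linarith) (by linarith)
  have h1 : (s * v 1) ^ 2 ≤ 2 ^ 2 := sq_le_sq' (by linarith) (by linarith)
  have : s ^ 2 ≤ 20 := by
    calc s ^ 2 = (s * v 0) ^ 2 + (s * v 1) ^ 2 := by rw [mul_pow, mul_pow, ← mul_add, hv', mul_one]
      _ ≤ 20 := by linarith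
  nlinarith

/-- The law of reflection on the ellipse, in terms of the vector `Q x = (x 0 / 4, x 1)`. -/
theorem reflection_ellipse {x n v v' : Plane} (hx : x ∈ frontier (ellipseDomain 2 1))
    (hn : IsOutwardUnitNormal (ellipseDomain 2 1) x n)
    (hv : v' = v - (2 * inner ℝ v n) • n) :
    ∃ c : ℝ, 0 < c ∧ c * ((x 0 / 4) ^ 2 + x 1 ^ 2) = 1 ∧
      v' 0 = v 0 - 2 * (c * (v 0 * (x 0 / 4) + v 1 * x 1)) * (x 0 / 4) ∧
      v' 1 = v 1 - 2 * (c * (v 0 * (x 0 / 4) + v 1 * x 1)) * x 1 := by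
  obtain ⟨r, hr, h0, h1⟩ := outwardUnitNormal_ellipse hx hn
  have hn1 := plane_norm_eq_one hn.1
  refine ⟨r ^ 2, by positivity, ?_, ?_, ?_⟩
  · rw [h0, h1] at hn1; linarith
  · rw [hv, plane_inner]
    simp only [PiLp.sub_apply, PiLp.smul_apply, smul_eq_mul]
    rw [h0, h1]; ring
  · rw [hv, plane_inner]
    simp only [PiLp.sub_apply, PiLp.smul_apply, smul_eq_mul]
    rw [h0, h1]; ring

/-- A reflection which reverses the component along `(1, -1)` while both directions are almost
orthogonal to `(1, 1)` takes place near the normal, hence away from grazing incidence. -/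
theorem joachimsthal_lower_bound {g h c J p q p' q' : ℝ}
    (hN : c * (g ^ 2 + h ^ 2) = 1) (hc : 0 < c) (hN' : 1 / 4 ≤ g ^ 2 + h ^ 2) (hJ : 0 < J)
    (hp : p' = p - 2 * (c * J) * g) (hq : q' = q - 2 * (c * J) * h)
    (hflip : 2 ≤ |(p - q) - (p' - q')|) : 1 / 3 ≤ J := by
  have h1 : (p - q) - (p' - q') = 2 * (c * J * (g - h)) := by rw [hp, hq]; ring
  rw [h1, abs_mul, abs_two] at hflip
  have h2 : 1 ≤ (c * J * (g - h)) ^ 2 := by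
    rw [← sq_abs]; nlinarith
  have h3 : (g - h) ^ 2 ≤ 2 * (g ^ 2 + h ^ 2) := by nlinarith [sq_nonneg (g + h)]
  have hc4 : c ≤ 4 := by nlinarith
  have h4 : 1 ≤ 8 * J ^ 2 := by
    calc (1 : ℝ) ≤ (c * J) ^ 2 * (g - h) ^ 2 := by linarith [mul_pow (c * J) (g - h) 2]
      _ ≤ (c * J) ^ 2 * (2 * (g ^ 2 + h ^ 2)) := by gcongr
      _ = 2 * c * J ^ 2 * (c * (g ^ 2 + h ^ 2)) := by ring
      _ = 2 * c * J ^ 2 := by rw [hN, mul_one]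
      _ ≤ 8 * J ^ 2 := by nlinarith [sq_nonneg J]
  nlinarith

/-- Away from grazing incidence, a reflection that hardly changes the component along (1, 1) must
have its normal almost orthogonal to (1, 1). -/
theorem abs_add_le_of_reflection {g h c J p q p' q' : ℝ}
    (hN : c * (g ^ 2 + h ^ 2) = 1) (hc : 0 < c) (hN' : g ^ 2 + h ^ 2 ≤ 1) (hJ : 1 / 3 ≤ J)
    (hp : p' = p - 2 * (c * J) * g) (hq : q' = q - 2 * (c * J) * h)
    (h1 : |p + q| < 1 / 30) (h2 : |p' + q'| < 1 / 30) : |g + h| ≤ 1 / 10 := by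
  have hc1 : 1 ≤ c := by nlinarith
  have h3 : 1 / 3 ≤ c * J := by nlinarith
  have h4 : (p + q) - (p' + q') = 2 * (c * J) * (g + h) := by rw [hp, hq]; ring
  have h5 : |2 * (c * J) * (g + h)| ≤ 1 / 15 := by
    rw [← h4]; exact (abs_sub _ _).trans (by linarith)
  rw [abs_mul, abs_of_pos (by linarith)] at h5
  nlinarith [abs_nonneg (g + h)]

/-- Two consecutive reflections near the points with normal `±(1, -1)` are not joined by a chord
almost parallel to `(1, -1)`, because these points are not vertices of the ellipse. -/
theorem chord_contradiction {x y x' y' p q s J : ℝ} (hs : 0 < s) (hs5 : s ≤ 5)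
    (hx : x' = x + s * p) (hy : y' = y + s * q) (hpq : p ^ 2 + q ^ 2 = 1)
    (hJ : 1 / 3 ≤ J) (hJ1 : p * (x' / 4) + q * y' = J) (hJ2 : p * (x / 4) + q * y = -J)
    (h1 : |x / 4 + y| ≤ 1 / 10) (h2 : |x' / 4 + y'| ≤ 1 / 10) (hσ : |p + q| < 1 / 30) :
    False := by
  -- The direction makes 3α + 5β small, and β is small at both ends, so α is small. Yet α(p - q) +
  -- β(p + q) = 4J ≥ 4/3.
  set α := (x' / 4 - y') - (x / 4 - y) with hα
  set β := (x' / 4 + y') - (x / 4 + y) with hβ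
  have e1 : 3 * α + 5 * β = 2 * (s * (p + q)) := by rw [hα, hβ, hx, hy]; ring
  have e2 : α * (p - q) + β * (p + q) = 4 * J := by rw [hα, hβ]; linarith
  have hβ1 : |β| ≤ 1 / 5 := (abs_sub _ _).trans (by linarith)
  have hs1 : |s * (p + q)| ≤ 1 / 6 := by
    rw [abs_mul, abs_of_pos hs]; nlinarith [abs_nonneg (p + q)]
  have hα1 : |α| ≤ 4 / 9 := by
    rw [abs_le] at *
    constructor <;> linarith [hβ1.1, hβ1.2, hs1.1, hs1.2]
  have hπ : |p - q| ≤ 3 / 2 := abs_le_of_sq_le_sq (by nlinarith [sq_nonneg (p + q)]) (by norm_num)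
  have b1 : |α * (p - q)| ≤ 4 / 9 * (3 / 2) := by
    rw [abs_mul]; gcongr
  have b2 : |β * (p + q)| ≤ 1 / 5 * (1 / 30) := by
    rw [abs_mul]; gcongr
  have := (abs_le.1 b1).2
  have := (abs_le.1 b2).2
  linarith

/-! ### Gliding rays -/

/-- Along a gliding ray, the eccentric angle turns in one direction, at a rate of at least `1/2`;
so it cannot stay in a closed half of the ellipse during the time `14`. -/
theorem glidingRay_meets_halfEllipse {γ : ℝ → Plane}
    (h : IsGlidingRay (ellipseDomain 2 1) γ) : ∃ t ∈ Ioo (0 : ℝ) 14, γ t ∈ halfEllipse := by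
  obtain ⟨hC, hF, hN⟩ := h
  have hd : ∀ t, HasDerivAt γ (deriv γ t) t := fun t =>
    (hC.differentiable one_ne_zero t).hasDerivAt
  have hdc : Continuous (deriv γ) := hC.continuous_deriv le_rfl
  have hdi : ∀ i t, HasDerivAt (fun t => γ t i) (deriv γ t i) t := fun i t =>
    (EuclideanSpace.proj i : Plane →L[ℝ] ℝ).hasFDerivAt.comp_hasDerivAt t (hd t)
  have hE : ∀ t, γ t 0 ^ 2 / 4 + γ t 1 ^ 2 = 1 := fun t => (mem_frontier_ellipse _).1 (hF t)
  have hT : ∀ t, γ t 0 * deriv γ t 0 / 2 + 2 * (γ t 1 * deriv γ t 1) = 0 := by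
    intro t
    have h1 := (((hdi 0 t).pow 2).div_const 4).add ((hdi 1 t).pow 2)
    have h2 : HasDerivAt (fun _ : ℝ => (1 : ℝ)) 0 t := hasDerivAt_const _ _
    have h3 := h1.unique (h2.congr_of_eventuallyEq (Eventually.of_forall hE))
    simp at h3
    linarith
  -- `ω` is the derivative of the eccentric angle; `ψ` below is the angle turned since time 0.
  set ω : ℝ → ℝ := fun t => γ t 0 / 2 * deriv γ t 1 - γ t 1 * (deriv γ t 0 / 2) with hω
  have hωc : Continuous ω := by
    have := hC.continuous
    fun_prop
  have hω0 : ∀ t, deriv γ t 0 = -2 * (ω t * γ t 1) := by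
    intro t
    have e1 := hE t
    have e2 := hT t
    simp only [hω]
    linear_combination (-(deriv γ t 0)) * e1 + γ t 0 * e2 / 2
  have hω1 : ∀ t, deriv γ t 1 = ω t * (γ t 0 / 2) := by
    intro t
    have e1 := hE t
    have e2 := hT t
    simp only [hω]
    linear_combination (-(deriv γ t 1)) * e1 + γ t 1 * e2 / 2
  have hω2 : ∀ t, 1 / 2 ≤ |ω t| := by
    intro t
    have e1 := hE t
    have e3 := plane_norm_eq_one (hN t)
    rw [hω0, hω1] at e3
    apply le_of_sq_le_sq _ (abs_nonneg _)
    rw [sq_abs]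
    nlinarith [mul_nonneg (sq_nonneg (ω t)) (sq_nonneg (γ t 0)), sq_nonneg (ω t)]
  obtain ⟨e, he, hsgn⟩ : ∃ e : ℝ, (e = 1 ∨ e = -1) ∧ ∀ t, 1 / 2 ≤ e * ω t := by
    have hne : ∀ t, ω t ≠ 0 := fun t h0 => by
      have := hω2 t; rw [h0, abs_zero] at this; linarith
    rcases lt_or_gt_of_ne (hne 0) with h0 | h0
    · refine ⟨-1, Or.inr rfl, fun t => ?_⟩
      have : ω t < 0 := by
        by_contra hc
        obtain ⟨z, hz⟩ := mem_range_of_exists_le_of_exists_ge hωc ⟨0, h0.le⟩ ⟨t, not_lt.1 hc⟩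
        exact hne z hz
      have h2 := hω2 t
      rw [abs_of_neg this] at h2; linarith
    · refine ⟨1, Or.inl rfl, fun t => ?_⟩
      have : 0 < ω t := by
        by_contra hc
        obtain ⟨z, hz⟩ := mem_range_of_exists_le_of_exists_ge hωc ⟨t, not_lt.1 hc⟩ ⟨0, h0.le⟩
        exact hne z hz
      have h2 := hω2 t
      rw [abs_of_pos this] at h2; linarith
  set ψ : ℝ → ℝ := fun t => ∫ u in (0 : ℝ)..t, ω u with hψ
  have hψd : ∀ t, HasDerivAt ψ (ω t) t := fun t => hωc.integral_hasStrictDerivAt 0 t |>.hasDerivAt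
  have hψc : Continuous ψ := continuous_iff_continuousAt.2 fun t => (hψd t).continuousAt
  have hψ0 : ψ 0 = 0 := by simp [hψ]
  have hψ14 : 7 ≤ e * ψ 14 := by
    have hmono : Monotone fun t => e * ψ t - t / 2 := by
      apply monotone_of_hasDerivAt_nonneg
        (f' := fun t => e * ω t - 1 / 2)
      · intro t
        exact ((hψd t).const_mul e).sub ((hasDerivAt_id t).div_const 2)
      · intro t
        simpa using hsgn t
    have := hmono (show (0 : ℝ) ≤ 14 by norm_num)
    simp only [hψ0] at this
    linarith
  -- Rotating (γ₀/2, γ₁) back by `ψ` recovers its initial value.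
  have hA : ∀ t, γ t 0 / 2 * Real.cos (ψ t) + γ t 1 * Real.sin (ψ t) = γ 0 0 / 2 := by
    intro t
    have hder : ∀ t, HasDerivAt
        (fun t => γ t 0 / 2 * Real.cos (ψ t) + γ t 1 * Real.sin (ψ t)) 0 t := by
      intro t
      have := (((hdi 0 t).div_const 2).mul (hψd t).cos).add ((hdi 1 t).mul (hψd t).sin)
      refine this.congr_deriv ?_
      rw [hω0, hω1]; ring
    have := is_const_of_deriv_eq_zero (fun t => (hder t).differentiableAt)
      (fun t => (hder t).deriv) t 0
    simpa [hψ0] using this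
  have hB : ∀ t, γ t 1 * Real.cos (ψ t) - γ t 0 / 2 * Real.sin (ψ t) = γ 0 1 := by
    intro t
    have hder : ∀ t, HasDerivAt
        (fun t => γ t 1 * Real.cos (ψ t) - γ t 0 / 2 * Real.sin (ψ t)) 0 t := by
      intro t
      have := ((hdi 1 t).mul (hψd t).cos).sub (((hdi 0 t).div_const 2).mul (hψd t).sin)
      refine this.congr_deriv ?_
      rw [hω0, hω1]; ring
    have := is_const_of_deriv_eq_zero (fun t => (hder t).differentiableAt)
      (fun t => (hder t).deriv) t 0
    simpa [hψ0] using this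
  have hee : e * e = 1 := by rcases he with rfl | rfl <;> norm_num
  have hex : ∀ r : ℝ, 0 < r → r < 7 → ∃ t ∈ Ioo (0 : ℝ) 14, ψ t = e * r := by
    intro r hr0 hr7
    have := intermediate_value_Ioo (show (0 : ℝ) ≤ 14 by norm_num)
      (f := fun t => e * ψ t) (by fun_prop)
    obtain ⟨t, ht, htr⟩ := this (show r ∈ Ioo (e * ψ 0) (e * ψ 14) from
      ⟨by rw [hψ0]; simpa using hr0, by linarith⟩)
    exact ⟨t, ht, by rw [← htr, ← mul_assoc, hee, one_mul]⟩
  by_contra hcon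
  push Not at hcon
  have hle : ∀ t ∈ Ioo (0 : ℝ) 14, γ t 0 / 4 + γ t 1 ≤ 0 := by
    intro t ht
    by_contra hc
    exact hcon t ht ⟨not_le.1 hc, hF t⟩
  have hpi := Real.pi_gt_three
  have hpi' := Real.pi_lt_d2
  have hcase : ∀ r : ℝ, 0 < r → r < 7 →
      (γ 0 0 / 2 * Real.cos (e * r) - γ 0 1 * Real.sin (e * r)) / 2
        + (γ 0 0 / 2 * Real.sin (e * r) + γ 0 1 * Real.cos (e * r)) ≤ 0 := by
    intro r h0 h7
    obtain ⟨t, ht, htr⟩ := hex r h0 h7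
    have a := hA t
    have b := hB t
    have l := hle t ht
    rw [htr] at a b
    have sc := Real.sin_sq_add_cos_sq (e * r)
    have c0 : γ 0 0 / 2 * Real.cos (e * r) - γ 0 1 * Real.sin (e * r) = γ t 0 / 2 := by
      rw [← a, ← b]; linear_combination (γ t 0 / 2) * sc
    have c1 : γ 0 0 / 2 * Real.sin (e * r) + γ 0 1 * Real.cos (e * r) = γ t 1 := by
      rw [← a, ← b]; linear_combination (γ t 1) * sc
    rw [c0, c1]; linarith
  -- All four quarter turns fit, since 2π < 7. Opposite positions in the closed half both lie on its
  -- bounding line, which cannot hold for two perpendicular pairs.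
  have r1 := hcase (Real.pi / 2) (by linarith) (by linarith)
  have r2 := hcase Real.pi (by linarith) (by linarith)
  have r3 := hcase (Real.pi + Real.pi / 2) (by linarith) (by linarith)
  have r4 := hcase (2 * Real.pi) (by linarith) (by linarith)
  have hc0 : ∀ z, Real.cos (e * z) = Real.cos z := by
    intro z; rcases he with rfl | rfl <;> simp
  have hs0 : ∀ z, Real.sin (e * z) = e * Real.sin z := by
    intro z; rcases he with rfl | rfl <;> simp
  simp only [hc0, hs0, Real.cos_pi_div_two, Real.sin_pi_div_two, Real.cos_pi, Real.sin_pi,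
    Real.cos_two_pi, Real.sin_two_pi, Real.cos_add, Real.sin_add] at r1 r2 r3 r4
  have e0 := hE 0
  have z1 : γ 0 1 = - γ 0 0 / 4 := by linarith
  have z2 : e * (γ 0 0 / 2 - γ 0 1 / 2) = 0 := by linarith
  have z3 : γ 0 0 / 2 - γ 0 1 / 2 = 0 := by
    rcases he with rfl | rfl <;> linarith
  have z4 : γ 0 0 = 0 := by linarith
  rw [z1, z4] at e0
  norm_num at e0

theorem glidingRay_nonDiffractive {γ : ℝ → Plane}
    (h : IsGlidingRay (ellipseDomain 2 1) γ) (t : ℝ) :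
    IsNonDiffractiveAt (ellipseDomain 2 1) γ t := by
  obtain ⟨hC, hF, hN⟩ := h
  have hd := (hC.differentiable one_ne_zero t).hasDerivAt
  have hdi : ∀ i, HasDerivAt (fun t => γ t i) (deriv γ t i) t := fun i =>
    (EuclideanSpace.proj i : Plane →L[ℝ] ℝ).hasFDerivAt.comp_hasDerivAt t hd
  refine ⟨deriv γ t, hd.hasDerivWithinAt, ?_⟩
  have h1 := (((hdi 0).pow 2).div_const 4).add ((hdi 1).pow 2)
  have h2 : HasDerivAt (fun _ : ℝ => (1 : ℝ)) 0 t := hasDerivAt_const _ _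
  have h3 := h1.unique (h2.congr_of_eventuallyEq
    (Eventually.of_forall fun s => (mem_frontier_ellipse _).1 (hF s)))
  simp at h3
  filter_upwards [self_mem_nhdsWithin] with s hs
  exact add_smul_notMem_closure_ellipse (hF t) (hN t) (by linarith) hs

/-! ### Reflected rays -/

theorem exists_lt_le_add_of_tendsto {τ : ℤ → ℝ} {D : ℝ} (hmono : StrictMono τ)
    (htop : Tendsto τ atTop atTop) (hbot : Tendsto τ atBot atBot)
    (hD : ∀ k, τ (k + 1) - τ k ≤ D) (t : ℝ) : ∃ k, t < τ k ∧ τ k ≤ t + D := by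
  obtain ⟨b, hb⟩ := (hbot.eventually_le_atBot t).exists
  obtain ⟨k, hk, hmin⟩ := Int.exists_least_of_bdd (P := fun k => t < τ k)
    ⟨b, fun z hz => by
      by_contra hc
      exact absurd (hmono.monotone (not_le.1 hc).le) (not_le.2 (hb.trans_lt hz))⟩
    (htop.eventually_gt_atTop t).exists
  refine ⟨k, hk, ?_⟩
  have h1 : τ (k - 1) ≤ t := by
    by_contra hc
    have := hmin (k - 1) (not_le.1 hc)
    omega
  have h2 := hD (k - 1)
  rw [sub_add_cancel] at h2
  linarith

/-- The displacement of a broken line whose directions all have component at least `c`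
along `(u, v)`. -/
theorem mul_sub_le_displacement {τ : ℤ → ℝ} {x ξ : ℤ → Plane} {u v c : ℝ}
    (hpos : ∀ k, 0 < τ (k + 1) - τ k)
    (hx : ∀ k, x (k + 1) = x k + (τ (k + 1) - τ k) • ξ k) {k m : ℤ} (hkm : k ≤ m)
    (hc : ∀ j, k ≤ j → j < m → c ≤ ξ j 0 * u + ξ j 1 * v) :
    c * (τ m - τ k) ≤ (x m 0 - x k 0) * u + (x m 1 - x k 1) * v := by
  induction m, hkm using Int.leInduction with
  | base => simp
  | succ m hm ih =>
    have h1 := ih fun j h h' => hc j h (by omega)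
    have h2 := hc m hm (by omega)
    have e0 : x (m + 1) 0 = x m 0 + (τ (m + 1) - τ m) * ξ m 0 := by rw [hx]; simp
    have e1 : x (m + 1) 1 = x m 1 + (τ (m + 1) - τ m) * ξ m 1 := by rw [hx]; simp
    rw [e0, e1]
    nlinarith [mul_le_mul_of_nonneg_left h2 (hpos m).le]

theorem reflections_meet_halfEllipse {τ : ℤ → ℝ} {x ξ : ℤ → Plane} (hmono : StrictMono τ)
    (htop : Tendsto τ atTop atTop) (hbot : Tendsto τ atBot atBot) (hξ : ∀ k, ‖ξ k‖ = 1)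
    (hx : ∀ k, x (k + 1) = x k + (τ (k + 1) - τ k) • ξ k)
    (hF : ∀ k, x k ∈ frontier (ellipseDomain 2 1))
    (hrefl : ∀ k, ∃ n, IsOutwardUnitNormal (ellipseDomain 2 1) (x k) n ∧
      ξ k = ξ (k - 1) - (2 * inner ℝ (ξ (k - 1)) n) • n) :
    ∃ k, 0 < τ k ∧ τ k < 500 ∧ x k ∈ halfEllipse := by
  by_contra hcon
  push Not at hcon
  have hpos : ∀ k, 0 < τ (k + 1) - τ k := fun k => sub_pos.2 (hmono (lt_add_one k))
  have hE : ∀ k, x k 0 ^ 2 / 4 + x k 1 ^ 2 = 1 := fun k => (mem_frontier_ellipse _).1 (hF k)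
  have hξ1 : ∀ k, ξ k 0 ^ 2 + ξ k 1 ^ 2 = 1 := fun k => plane_norm_eq_one (hξ k)
  have h5 : ∀ k, τ (k + 1) - τ k ≤ 5 := fun k => chord_length_le (hF k) (hF (k + 1)) (hξ k) (hx k)
  have hJ := fun k => chord_joachimsthal (hF k) (hF (k + 1)) (hξ k) (hpos k) (hx k)
  have hJ' : ∀ k, 0 < ξ (k - 1) 0 * (x k 0 / 4) + ξ (k - 1) 1 * x k 1 := fun k => by
    have := (hJ (k - 1)).2
    rwa [sub_add_cancel] at this
  have hR := fun k => (hrefl k).elim fun n hn => reflection_ellipse (hF k) hn.1 hn.2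
  have hbd : ∀ k m, |(x m 0 - x k 0)| ≤ 4 ∧ |x m 1 - x k 1| ≤ 2 := by
    intro k m
    obtain ⟨a1, a2⟩ := abs_le_of_mem_frontier_ellipse (hF k)
    obtain ⟨b1, b2⟩ := abs_le_of_mem_frontier_ellipse (hF m)
    exact ⟨(abs_sub _ _).trans (by linarith), (abs_sub _ _).trans (by linarith)⟩
  have hfind := exists_lt_le_add_of_tendsto hmono htop hbot h5
  -- Reflections occur within 5 of any time. The outer periods, from `k₀` to `k₁` and from `k₂ + 1`
  -- to `k₃`, last at least 195; the middle one, from `k₁` to `k₂`, at least 15.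
  obtain ⟨k₀, h0l, h0u⟩ := hfind 0
  obtain ⟨k₁, h1l, h1u⟩ := hfind 200
  obtain ⟨k₂, h2l, h2u⟩ := hfind 220
  obtain ⟨k₃, h3l, h3u⟩ := hfind 430
  have h22 := h5 k₂
  have l01 : k₀ < k₁ := hmono.lt_iff_lt.1 (by linarith)
  have l12 : k₁ < k₂ := hmono.lt_iff_lt.1 (by linarith)
  have l23 : k₂ + 1 < k₃ := hmono.lt_iff_lt.1 (by linarith)
  have hstep : ∀ k, k₀ ≤ k → k ≤ k₃ → ξ (k - 1) 0 + ξ (k - 1) 1 ≤ ξ k 0 + ξ k 1 := by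
    intro k hk hk'
    have t1 := hmono.monotone hk
    have t2 := hmono.monotone hk'
    have hle : x k 0 / 4 + x k 1 ≤ 0 := by
      by_contra hc
      exact hcon k (by linarith) (by linarith) ⟨not_le.1 hc, hF k⟩
    obtain ⟨c, hc, -, e0, e1⟩ := hR k
    rw [e0, e1]
    nlinarith [mul_nonneg (mul_pos hc (hJ' k)).le (neg_nonneg.2 hle)]
  have hσ : ∀ i j, k₀ ≤ i → i ≤ j → j ≤ k₃ → ξ i 0 + ξ i 1 ≤ ξ j 0 + ξ j 1 := by
    intro i j hi hij
    induction j, hij using Int.leInduction with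
    | base => exact fun _ => le_rfl
    | succ j hj ih =>
      intro hj'
      have := hstep (j + 1) (by omega) hj'
      rw [add_sub_cancel_right] at this
      exact (ih (by omega)).trans this
  -- By monotonicity, a component beyond ±1/30 would persist through a whole outer period and give a
  -- displacement of at least 195/30 > 6 = 4 + 2.
  have hsmall : ∀ j, k₁ ≤ j → j ≤ k₂ + 1 → |ξ j 0 + ξ j 1| < 1 / 30 := by
    intro j hj hj'
    have t1 := hmono.monotone hj
    have t2 := hmono.monotone hj'
    rw [abs_lt]
    constructor
    · by_contra hc
      have := mul_sub_le_displacement (u := -1) (v := -1) (c := 1 / 30) hpos hx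
        (show k₀ ≤ j by omega) (fun i hi hij => by
          have := hσ i j hi hij.le (by omega)
          linarith)
      obtain ⟨b0, b1⟩ := hbd k₀ j
      linarith [(abs_le.1 b0).1, (abs_le.1 b1).1]
    · by_contra hc
      have := mul_sub_le_displacement (u := 1) (v := 1) (c := 1 / 30) hpos hx
        (show j ≤ k₃ by omega) (fun i hi hij => by
          have := hσ j i (by omega) hi hij.le
          linarith)
      obtain ⟨b0, b1⟩ := hbd j k₃
      linarith [(abs_le.1 b0).2, (abs_le.1 b1).2]
  have hbig : ∀ j, k₁ ≤ j → j ≤ k₂ + 1 → 1 ≤ |ξ j 0 - ξ j 1| := by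
    intro j hj hj'
    have h1 := abs_lt.1 (hsmall j hj hj')
    have h2 := hξ1 j
    apply le_of_sq_le_sq _ (abs_nonneg _)
    rw [sq_abs]
    nlinarith
  -- Without a sign change the displacement along ±(1, -1) would be at least 15 > 6.
  obtain ⟨k, hk1, hk2, hflip⟩ : ∃ k, k₁ < k ∧ k ≤ k₂ ∧
      2 ≤ |(ξ (k - 1) 0 - ξ (k - 1) 1) - (ξ k 0 - ξ k 1)| := by
    by_contra hno
    push Not at hno
    have hsign : ∀ e : ℝ, e = 1 ∨ e = -1 → 1 ≤ e * (ξ k₁ 0 - ξ k₁ 1) →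
        ∀ j, k₁ ≤ j → j ≤ k₂ → 1 ≤ e * (ξ j 0 - ξ j 1) := by
      intro e he hstart j hj
      induction j, hj using Int.leInduction with
      | base => exact fun _ => hstart
      | succ j hj ih =>
        intro hj'
        have i1 := ih (by omega)
        have i2 := abs_lt.1 (hno (j + 1) (by omega) hj')
        rw [add_sub_cancel_right] at i2
        rcases le_abs.1 (hbig (j + 1) (by omega) (by omega)) with b | b <;>
          rcases he with rfl | rfl <;> linarith [i2.1, i2.2]
    obtain ⟨e, he, hstart⟩ : ∃ e : ℝ, (e = 1 ∨ e = -1) ∧ 1 ≤ e * (ξ k₁ 0 - ξ k₁ 1) := by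
      rcases le_abs.1 (hbig k₁ le_rfl (by omega)) with b | b
      · exact ⟨1, Or.inl rfl, by linarith⟩
      · exact ⟨-1, Or.inr rfl, by linarith⟩
    have := mul_sub_le_displacement (u := e) (v := -e) (c := 1) hpos hx l12.le
      (fun i hi hij => by
        have := hsign e he hstart i hi hij.le
        linarith)
    obtain ⟨b0, b1⟩ := hbd k₁ k₂
    rw [abs_le] at b0 b1
    rcases he with rfl | rfl <;> linarith [b0.1, b0.2, b1.1, b1.2]
  have hN : ∀ j, 1 / 4 ≤ (x j 0 / 4) ^ 2 + x j 1 ^ 2 ∧ (x j 0 / 4) ^ 2 + x j 1 ^ 2 ≤ 1 := by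
    intro j
    have := hE j
    constructor <;> nlinarith [sq_nonneg (x j 0), sq_nonneg (x j 1)]
  obtain ⟨c, hc, hcN, e0, e1⟩ := hR k
  have hJ3 := joachimsthal_lower_bound hcN hc (hN k).1 (hJ' k) e0 e1 hflip
  have s1 := hsmall (k - 1) (by omega) (by omega)
  have s2 := hsmall k (by omega) (by omega)
  have s3 := hsmall (k + 1) (by omega) (by omega)
  have g1 := abs_add_le_of_reflection hcN hc (hN k).2 hJ3 e0 e1 s1 s2
  have hout : ξ k 0 * (x k 0 / 4) + ξ k 1 * x k 1
      = -(ξ (k - 1) 0 * (x k 0 / 4) + ξ (k - 1) 1 * x k 1) := by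
    rw [e0, e1]
    linear_combination (-2 * (ξ (k - 1) 0 * (x k 0 / 4) + ξ (k - 1) 1 * x k 1)) * hcN
  have hin := (hJ k).1
  rw [hout, neg_neg] at hin
  -- The reflection at `k + 1` need not turn the ray back; its bound on J is inherited from `k`.
  obtain ⟨d, hd, hdN, f0, f1⟩ := hR (k + 1)
  rw [add_sub_cancel_right] at f0 f1
  have g2 := abs_add_le_of_reflection hdN hd (hN (k + 1)).2 (hin ▸ hJ3) f0 f1 s2 s3
  exact chord_contradiction (hpos k) (h5 k) (by rw [hx]; simp) (by rw [hx]; simp) (hξ1 k)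
    hJ3 hin hout g1 g2 s2

/-! ### Geometric control and conclusion -/

theorem geometricControl_halfEllipse : GeometricControl (ellipseDomain 2 1) halfEllipse := by
  refine ⟨500, by norm_num, ?_⟩
  rintro γ (⟨τ, ξ, hmono, htop, hbot, hξ, hγ, -, hF, hrefl⟩ | hglide)
  · have hx : ∀ k, γ (τ (k + 1)) = γ (τ k) + (τ (k + 1) - τ k) • ξ k := fun k =>
      hγ k _ (right_mem_Icc.2 (hmono (lt_add_one k)).le)
    obtain ⟨k, hk0, hk1, hk⟩ := reflections_meet_halfEllipse (x := fun k => γ (τ k))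
      hmono htop hbot hξ hx hF hrefl
    have hlt : τ (k - 1) < τ k := hmono (by omega)
    have hγ' := hγ (k - 1)
    have hJ := chord_joachimsthal (hF (k - 1)) (hF (k - 1 + 1)) (hξ (k - 1))
      (sub_pos.2 (hmono (lt_add_one _))) (hx (k - 1))
    rw [sub_add_cancel] at hγ' hJ
    refine ⟨τ k, ⟨hk0, hk1⟩, hk, ξ (k - 1), ?_, ?_⟩
    · have hline : HasDerivAt (fun t => γ (τ (k - 1)) + (t - τ (k - 1)) • ξ (k - 1))
          (ξ (k - 1)) (τ k) := by
        simpa using (((hasDerivAt_id (τ k)).sub_const (τ (k - 1))).smul_const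
          (ξ (k - 1))).const_add (γ (τ (k - 1)))
      refine hline.hasDerivWithinAt.congr_of_eventuallyEq ?_
        (hγ' _ (right_mem_Icc.2 hlt.le))
      filter_upwards [self_mem_nhdsWithin, mem_nhdsWithin_of_mem_nhds (lt_mem_nhds hlt)]
        with t ht ht'
      exact hγ' t ⟨ht'.le, ht⟩
    · filter_upwards [self_mem_nhdsWithin] with s hs
      exact add_smul_notMem_closure_ellipse (hF k) (hξ _) hJ.2.le hs
  · obtain ⟨t, ht, hmem⟩ := glidingRay_meets_halfEllipse hglide
    exact ⟨t, ⟨ht.1, ht.2.trans (by norm_num)⟩, hmem, glidingRay_nonDiffractive hglide t⟩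

theorem mainTheorem6 :
    ∃ Ω Γ : Set Plane,
      (∃ a b : ℝ, 0 < b ∧ b < a ∧ Ω = ellipseDomain a b) ∧
      IsOpen Ω ∧ Bornology.IsBounded Ω ∧ StrictConvex ℝ (closure Ω) ∧
      Γ ⊆ frontier Ω ∧ (∃ U : Set Plane, IsOpen U ∧ Γ = U ∩ frontier Ω) ∧ IsConnected Γ ∧
      GeometricControl Ω Γ ∧
      ¬ ∃ x₀ : Plane, Γ = gammaRegion Ω x₀ :=
  ⟨ellipseDomain 2 1, halfEllipse, ⟨2, 1, by norm_num, by norm_num, rfl⟩, isOpen_ellipse,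
    isBounded_ellipse, strictConvex_closure_ellipse, inter_subset_right,
    ⟨_, isOpen_lt (by fun_prop) (by fun_prop), rfl⟩, isConnected_halfEllipse,
    geometricControl_halfEllipse, fun ⟨x₀, h⟩ => halfEllipse_ne_gammaRegion x₀ h⟩
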